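/- Work over the site of smooth manifolds (possibly infinite-dimensional Banach manifolds, modelled on a fixed Banach space for each manifold, not necessarily Hausdorff) with the open-cover topology. A stack is a category fibred in groupoids satisfying descent. A chart of a stack $\mathcal X$ is a manifold $X_0$ with a morphism $p_x\colon X_0\to\mathcal X$ that is a representable surjective submersion, and a differentiable stack is a stack admitting a chart. A chart presents $\mathcal X$ by the Lie groupoid $X=(X_1\rightrightarrows X_0)$, where $X_1=X_0\times_{p_x,\mathcal X,p_x}X_0$ has as points the triples $(a,\gamma,a')$ with $\gamma\colon p_x(a')\to p_x(a)$ in $\mathcal X$, and $t(a,\gamma,a')=a$, $s(a,\gamma,a')=a'$, $(a,\gamma,a')\cdot(a',\gamma',a'')=(a,\gamma\circ\gamma',a'')$. Let $\mathcal X,\mathcal Y$ be differentiable stacks with charts $p_x\colon X_0\to\mathcal X$, $p_y\colon Y_0\to\mathcal Y$ and presenting Lie groupoids $X$, $Y$. Let $\Phi\colon\mathcal X\to\mathcal Y$ be a morphism of stacks, $\phi\colon X_0\to Y_0$ a smooth map, and $\alpha\colon p_y\circ\phi\Rightarrow\Phi\circ p_x$ a 2-morphism. The Hilsum--Skandalis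 (H.S.) morphism presenting $\Phi$ is the right-principal bibundle $E_\Phi=X_0\times_{\Phi\circ p_x,\mathcal Y,p_y}Y_0$ from $X$ to $Y$: its points are triples $(a,\gamma,b)$ with $\gamma\colon p_y(b)\to\Phi(p_x(a))$, its moment maps are the two projections, and the actions are $(a',\eta,a)\cdot(a,\gamma,b)=(a',\Phi(\eta)\circ\gamma,b)$ and $(a,\gamma,b)\cdot(b,\delta,b')=(a,\gamma\circ\delta,b')$. Then this H.S. morphism is a strict Lie groupoid morphism. That is, there is a smooth map $\phi_1\colon X_1\to Y_1$, given on points by $$\phi_1(a,\gamma,a')=\bigl(\phi(a),\ \alpha_a^{-1}\circ\Phi(\gamma)\circ\alpha_{a'},\ \phi(a')\bigr),$$ such that $(\phi_1,\phi)$ is a morphism of Lie groupoids $X\to Y$ (it preserves source, target, units and multiplication), and $E_\Phi$ is the H.S. bibundle of $(\phi_1,\phi)$: there is an isomorphism $$E_\Phi\cong X_0\times_{\phi,Y_0,t}Y_1$$ of manifolds compatible with the moment maps and with the actions of $X$ and $Y$, where on the right the moment maps are $(a,y)\mapsto a$ and $(a,y)\mapsto s(y)$, and the actions are $g\cdot(a,y)=(t(g),\phi_1(g)y)$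 and $(a,y)\cdot h=(a,yh)$. -/

import Mathlib

open CategoryTheory
open scoped ContDiff

universe u v v₁ u₁ v₂ u₂

namespace DiffStack

/-! ## The site of manifolds -/

/-- A smooth (`C^∞`) manifold without boundary, modelled on a real Banach space.  Finite-dimensional
manifolds are the case of a finite-dimensional model space.  Neither Hausdorff nor second countable
is required, as usual for the arrow spaces of Lie groupoids. -/
structure Mfd : Type (u + 1) where
  carrier : Type u
  model : Type u
  [top : TopologicalSpace carrier]
  [normed : NormedAddCommGroup model]
  [space : NormedSpace ℝ model]
  [complete : CompleteSpace model]
  [charted : ChartedSpace model carrier]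
  [smooth : IsManifold (modelWithCornersSelf ℝ model) ∞ carrier]

attribute [instance] Mfd.top Mfd.normed Mfd.space Mfd.complete Mfd.charted Mfd.smooth

instance : CoeSort Mfd.{u} (Type u) := ⟨Mfd.carrier⟩

/-- Smooth maps. -/
@[ext]
structure Mfd.Hom (M N : Mfd.{u}) : Type u where
  toFun : M → N
  contMDiff : ContMDiff (modelWithCornersSelf ℝ M.model) (modelWithCornersSelf ℝ N.model) ∞ toFun

instance : Category Mfd.{u} where
  Hom := Mfd.Hom
  id M := ⟨id, contMDiff_id⟩
  comp f g := ⟨g.toFun ∘ f.toFun, g.contMDiff.comp f.contMDiff⟩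

/-- An open subset of a manifold, as a manifold. -/
noncomputable def Mfd.opens (M : Mfd.{u}) (U : TopologicalSpace.Opens M) : Mfd.{u} where
  carrier := U
  model := M.model

/-- The inclusion of an open subset. -/
noncomputable def Mfd.ι (M : Mfd.{u}) (U : TopologicalSpace.Opens M) : M.opens U ⟶ M :=
  Mfd.Hom.mk (M := M.opens U) (N := M) (Subtype.val : U → M)
    (contMDiff_subtype_val (I := modelWithCornersSelf ℝ M.model) (U := U))

/-- The coverings of the site of manifolds: open coverings. -/
def openCovers : Precoverage Mfd.{u} where
  coverings M := {R | ∃ (ι : Type u) (U : ι → TopologicalSpace.Opens M),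
    (⨆ i, U i) = ⊤ ∧ R = Presieve.ofArrows (fun i => M.opens (U i)) (fun i => M.ι (U i))}

/-- The Grothendieck topology of open coverings. -/
def openTopology : GrothendieckTopology Mfd.{u} := openCovers.toGrothendieck

/-- A surjective submersion.  (Being a submersion means looking locally, in charts, like a
projection `E × F → E` of Banach spaces.) -/
def IsSurjSubmersion {M N : Mfd.{u}} (f : M ⟶ N) : Prop :=
  Function.Surjective (Mfd.Hom.toFun f) ∧
    ∀ x : M, Manifold.IsSubmersionAt (modelWithCornersSelf ℝ M.model) (modelWithCornersSelf ℝ N.model) ∞ (Mfd.Hom.toFun f) x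

/-! ## Stacks as categories fibred in groupoids

A category over `C` is a `BasedCategory C`; a morphism of such is a `BasedFunctor` and a
2-morphism is a `BasedNatTrans`, i.e. a natural transformation lying over identities. -/

section Stacks

variable {C : Type u} [Category.{v} C]

/-- `𝒳 → C` is a category fibred in groupoids. -/
class IsFibredInGroupoids (𝒳 : BasedCategory.{v₁, u₁} C) : Prop where
  exists_lift : ∀ (x : 𝒳.obj) {R : C} (f : R ⟶ 𝒳.p.obj x),
    ∃ (y : 𝒳.obj) (φ : y ⟶ x), 𝒳.p.IsHomLift f φ
  cartesian : ∀ {x y : 𝒳.obj} (φ : x ⟶ y), 𝒳.p.IsStronglyCartesian (𝒳.p.map φ) φ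

/-- An object `X` of `C` viewed as a category over `C`: objects over `T` are morphisms `T ⟶ X`. -/
abbrev rep (X : C) : BasedCategory.{v, max u v} C := BasedCategory.ofFunctor (Over.forget X)

/-- A morphism of `C` viewed as a morphism of categories over `C`. -/
def repMap {X Y : C} (f : X ⟶ Y) : rep X ⥤ᵇ rep Y where
  toFunctor := Over.map f
  w := rfl

/-- A sieve on `U`, viewed as a full subcategory of the category over `C` represented by `U`. -/
abbrev sieveCat {U : C} (S : Sieve U) : BasedCategory.{v, max u v} C :=
  BasedCategory.ofFunctor S.arrows.diagram

/-- The inclusion of a sieve. -/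
def sieveIncl {U : C} (S : Sieve U) : sieveCat S ⥤ᵇ rep U where
  toFunctor := ObjectProperty.ι (fun f : Over U => S.arrows f.hom)
  w := rfl

/-- Restriction of morphisms `U → 𝒳` to a sieve on `U`. -/
def sieveRestrict {U : C} (S : Sieve U) (𝒳 : BasedCategory.{v₁, u₁} C) :
    (rep U ⥤ᵇ 𝒳) ⥤ (sieveCat S ⥤ᵇ 𝒳) where
  obj F := (sieveIncl S).comp F
  map α := BasedCategory.whiskerLeft (sieveIncl S) α

/-- Descent: objects and morphisms of `𝒳` glue uniquely along covering sieves.  Morphisms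
`S → 𝒳` from a sieve are the descent data for `S`. -/
def IsStack (J : GrothendieckTopology C) (𝒳 : BasedCategory.{v₁, u₁} C) : Prop :=
  ∀ (U : C) (S : Sieve U), S ∈ J U → (sieveRestrict S 𝒳).IsEquivalence

section Points

variable {𝒵 : BasedCategory.{v₁, u₁} C} {X Y Z : C}

/-- The object over `T` which is the value of `F : X → 𝒵` at `a : T ⟶ X`. -/
def ev (F : rep X ⥤ᵇ 𝒵) {T : C} (a : T ⟶ X) : 𝒵.obj := F.obj (Over.mk a)

/-- The value of `F : X → 𝒵` at the morphism `a' → a` over `h : T' ⟶ T`. -/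
def res (F : rep X ⥤ᵇ 𝒵) {T' T : C} (h : T' ⟶ T) {a' : T' ⟶ X} {a : T ⟶ X} (e : h ≫ a = a') :
    ev F a' ⟶ ev F a :=
  F.map (X := Over.mk a') (Y := Over.mk a) (Over.homMk h e)

/-- The objects over `T` of the fibre product `X ×_𝒵 Y`: triples `(a, γ, b)` with `a : T ⟶ X`,
`b : T ⟶ Y` and `γ : G(b) → F(a)` a morphism of `𝒵` over `T`. -/
structure FibPt (F : rep X ⥤ᵇ 𝒵) (G : rep Y ⥤ᵇ 𝒵) (T : C) where
  a : T ⟶ X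
  b : T ⟶ Y
  γ : ev G b ⟶ ev F a
  isHomLift : 𝒵.p.IsHomLift (𝟙 T) γ

/-- `h : T' ⟶ T` underlies a (necessarily unique) morphism `x' → x` of the fibre product
`X ×_𝒵 Y`, i.e. a pair of morphisms `x'.a → x.a` and `x'.b → x.b` over `h` whose images in `𝒵` form
a commutative square with the `γ`s. -/
def IsMor {F : rep X ⥤ᵇ 𝒵} {G : rep Y ⥤ᵇ 𝒵} {T' T : C} (h : T' ⟶ T)
    (x' : FibPt F G T') (x : FibPt F G T) : Prop :=
  ∃ (ha : h ≫ x.a = x'.a) (hb : h ≫ x.b = x'.b), x'.γ ≫ res F h ha = res G h hb ≫ x.γ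

/-- An object `P` of `C` representing the fibre product `X ×_𝒵 Y`: the category `X ×_𝒵 Y` over `C`
is represented by `P` through the universal triple `univ` over `P`.  Thus `univ.a` and `univ.b` are
the two projections of `P`. -/
structure FibProd (F : rep X ⥤ᵇ 𝒵) (G : rep Y ⥤ᵇ 𝒵) where
  P : C
  univ : FibPt F G P
  existsUnique : ∀ {T : C} (x : FibPt F G T), ∃! h : T ⟶ P, IsMor h x univ

/-! ### Elementary facts -/

instance res_isHomLift (F : rep X ⥤ᵇ 𝒵) {T' T : C} (h : T' ⟶ T) {a' : T' ⟶ X} {a : T ⟶ X}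
    (e : h ≫ a = a') : 𝒵.p.IsHomLift h (res F h e) :=
  have : (rep X).p.IsHomLift h (Over.homMk h e : Over.mk a' ⟶ Over.mk a) :=
    inferInstanceAs ((Over.forget X).IsHomLift
      ((Over.forget X).map (Over.homMk h e : Over.mk a' ⟶ Over.mk a)) _)
  BasedFunctor.preserves_isHomLift F h _

lemma res_id (F : rep X ⥤ᵇ 𝒵) {T : C} {a : T ⟶ X} (e : 𝟙 T ≫ a = a) :
    res F (𝟙 T) e = 𝟙 (ev F a) := by
  have : (Over.homMk (𝟙 T) e : Over.mk a ⟶ Over.mk a) = 𝟙 _ := by ext; rfl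
  exact (congrArg (fun m => F.map (X := Over.mk a) (Y := Over.mk a) m) this).trans
    (F.toFunctor.map_id (Over.mk a))

lemma res_comp (F : rep X ⥤ᵇ 𝒵) {T'' T' T : C} (k : T'' ⟶ T') (h : T' ⟶ T) (l : T'' ⟶ T)
    (hl : k ≫ h = l) {a'' : T'' ⟶ X} {a' : T' ⟶ X} {a : T ⟶ X} (e' : k ≫ a' = a'')
    (e : h ≫ a = a') (e'' : l ≫ a = a'') :
    res F k e' ≫ res F h e = res F l e'' := by
  subst hl
  have : (Over.homMk (k ≫ h) e'' : Over.mk a'' ⟶ Over.mk a) =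
    (Over.homMk k e' : Over.mk a'' ⟶ Over.mk a') ≫ (Over.homMk h e : Over.mk a' ⟶ Over.mk a) := by
    ext; rfl
  exact ((congrArg (fun m => F.map (X := Over.mk a'') (Y := Over.mk a) m) this).trans
    (F.toFunctor.map_comp (X := Over.mk a'') (Y := Over.mk a') (Z := Over.mk a) _ _)).symm

lemma ev_proj (F : rep X ⥤ᵇ 𝒵) {T : C} (a : T ⟶ X) : 𝒵.p.obj (ev F a) = T :=
  F.w_obj (Over.mk a)

/-- In a category fibred in groupoids every morphism is strongly cartesian. -/
lemma cartesian_of_lift [IsFibredInGroupoids 𝒵] {R S : C} (f : R ⟶ S) {x y : 𝒵.obj} (φ : x ⟶ y)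
    [h : 𝒵.p.IsHomLift f φ] : 𝒵.p.IsStronglyCartesian f φ := by
  cases h
  exact IsFibredInGroupoids.cartesian φ

lemma isIso_of_lift_id [IsFibredInGroupoids 𝒵] {T : C} {x y : 𝒵.obj} (φ : x ⟶ y)
    [𝒵.p.IsHomLift (𝟙 T) φ] : IsIso φ :=
  have := cartesian_of_lift (𝟙 T) φ
  Functor.IsStronglyCartesian.isIso_of_base_isIso 𝒵.p (𝟙 T) φ

instance FibPt.instIsHomLift {F : rep X ⥤ᵇ 𝒵} {G : rep Y ⥤ᵇ 𝒵} {T : C} (x : FibPt F G T) :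
    𝒵.p.IsHomLift (𝟙 T) x.γ := x.isHomLift

instance FibPt.instIsIso [IsFibredInGroupoids 𝒵] {F : rep X ⥤ᵇ 𝒵} {G : rep Y ⥤ᵇ 𝒵} {T : C}
    (x : FibPt F G T) : IsIso x.γ := isIso_of_lift_id (T := T) x.γ

variable {W : C} {F : rep X ⥤ᵇ 𝒵} {G : rep Y ⥤ᵇ 𝒵} {K : rep Z ⥤ᵇ 𝒵} {L : rep W ⥤ᵇ 𝒵}

namespace FibPt

/-- `(a, γ, b) · (b, δ, c) = (a, γ ∘ δ, c)`.  The middle factor is the identity of `G(b)`. -/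
def comp {T : C} (x : FibPt F G T) (y : FibPt G K T) (e : x.b = y.a) : FibPt F K T where
  a := x.a
  b := y.b
  γ := y.γ ≫ res G (𝟙 T) ((Category.id_comp _).trans e) ≫ x.γ
  isHomLift := by infer_instance

/-- The triple `(a, id, a)`. -/
def unit (F : rep X ⥤ᵇ 𝒵) {T : C} (a : T ⟶ X) : FibPt F F T where
  a := a
  b := a
  γ := 𝟙 _
  isHomLift := IsHomLift.id (ev_proj F a)

/-- The triple `(b, γ⁻¹, a)`. -/
noncomputable def symm [IsFibredInGroupoids 𝒵] {T : C} (x : FibPt F G T) : FibPt G F T where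
  a := x.b
  b := x.a
  γ := inv x.γ
  isHomLift := by infer_instance

/-- The image `Φ(γ)` of a morphism `γ : G(b) → F(a)` of `𝒵` under `Φ : 𝒵 → 𝒲`. -/
def imageHom {𝒲 : BasedCategory.{v₂, u₂} C} (Φ : 𝒵 ⥤ᵇ 𝒲) {T : C} (x : FibPt F G T) :
    ev (G.comp Φ) x.b ⟶ ev (F.comp Φ) x.a :=
  Φ.map x.γ

instance imageHom_isHomLift {𝒲 : BasedCategory.{v₂, u₂} C} (Φ : 𝒵 ⥤ᵇ 𝒲) {T : C}
    (x : FibPt F G T) : 𝒲.p.IsHomLift (𝟙 T) (x.imageHom Φ) :=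
  BasedFunctor.preserves_isHomLift Φ (𝟙 T) x.γ

/-- The image `(a, Φ(γ), b)` of a triple under a morphism `Φ`. -/
def image {𝒲 : BasedCategory.{v₂, u₂} C} (Φ : 𝒵 ⥤ᵇ 𝒲) {T : C} (x : FibPt F G T) :
    FibPt (F.comp Φ) (G.comp Φ) T where
  a := x.a
  b := x.b
  γ := x.imageHom Φ
  isHomLift := inferInstance

/-- The pullback of a triple over `T` along `h : T' ⟶ T`. -/
noncomputable def pull [IsFibredInGroupoids 𝒵] {T' T : C} (h : T' ⟶ T) (x : FibPt F G T) :
    FibPt F G T' :=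
  haveI := cartesian_of_lift h (res F h (rfl : h ≫ x.a = h ≫ x.a))
  haveI : 𝒵.p.IsHomLift h (res G h (rfl : h ≫ x.b = h ≫ x.b) ≫ x.γ) :=
    IsHomLift.comp_lift_id_right 𝒵.p h _ _
  { a := h ≫ x.a
    b := h ≫ x.b
    γ := Functor.IsStronglyCartesian.map 𝒵.p h (res F h (rfl : h ≫ x.a = h ≫ x.a))
      (Category.id_comp h).symm (res G h (rfl : h ≫ x.b = h ≫ x.b) ≫ x.γ)
    isHomLift := inferInstance }

lemma isMor_pull [IsFibredInGroupoids 𝒵] {T' T : C} (h : T' ⟶ T) (x : FibPt F G T) :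
    IsMor h (x.pull h) x := by
  have := cartesian_of_lift h (res F h (rfl : h ≫ x.a = h ≫ x.a))
  have : 𝒵.p.IsHomLift h (res G h (rfl : h ≫ x.b = h ≫ x.b) ≫ x.γ) :=
    IsHomLift.comp_lift_id_right 𝒵.p h _ _
  have key := Functor.IsStronglyCartesian.fac 𝒵.p h (res F h (rfl : h ≫ x.a = h ≫ x.a))
    (Category.id_comp h).symm (res G h (rfl : h ≫ x.b = h ≫ x.b) ≫ x.γ)
  exact ⟨rfl, rfl, key⟩

end FibPt

lemma IsMor.trans {T'' T' T : C} {k : T'' ⟶ T'} {h : T' ⟶ T} {x'' : FibPt F G T''}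
    {x' : FibPt F G T'} {x : FibPt F G T} (hk : IsMor k x'' x') (hh : IsMor h x' x) :
    IsMor (k ≫ h) x'' x := by
  obtain ⟨ka, kb, kc⟩ := hk
  obtain ⟨ha, hb, hc⟩ := hh
  refine ⟨by rw [Category.assoc, ha, ka], by rw [Category.assoc, hb, kb], ?_⟩
  rw [← res_comp F k h _ rfl ka ha, ← res_comp G k h _ rfl kb hb, ← Category.assoc, kc,
    Category.assoc, hc, Category.assoc]

lemma IsMor.refl {T : C} (x : FibPt F G T) : IsMor (𝟙 T) x x :=
  ⟨Category.id_comp _, Category.id_comp _, by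
    rw [res_id, res_id, Category.comp_id, Category.id_comp]⟩

lemma IsMor.eq {T : C} {x y : FibPt F G T} (h : IsMor (𝟙 T) x y) : x = y := by
  obtain ⟨a, b, γ, hγ⟩ := x
  obtain ⟨a', b', γ', hγ'⟩ := y
  obtain ⟨ha, hb, hc⟩ := h
  obtain rfl : a' = a := (Category.id_comp _).symm.trans ha
  obtain rfl : b' = b := (Category.id_comp _).symm.trans hb
  dsimp only at hc
  rw [res_id, res_id, Category.comp_id, Category.id_comp] at hc
  subst hc
  rfl

/-- Morphisms of the fibre product are cartesian. -/
lemma IsMor.cancel [IsFibredInGroupoids 𝒵] {T'' T' T : C} {k : T'' ⟶ T'} {h : T' ⟶ T}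
    {x'' : FibPt F G T''} {x' : FibPt F G T'} {x : FibPt F G T}
    (hkh : IsMor (k ≫ h) x'' x) (hh : IsMor h x' x) : IsMor k x'' x' := by
  obtain ⟨ka, kb, kc⟩ := hkh
  obtain ⟨ha, hb, hc⟩ := hh
  have ea : k ≫ x'.a = x''.a := by rw [← ha, ← ka, Category.assoc]
  have eb : k ≫ x'.b = x''.b := by rw [← hb, ← kb, Category.assoc]
  refine ⟨ea, eb, ?_⟩
  have := cartesian_of_lift h (res F h ha)
  have : 𝒵.p.IsHomLift k (x''.γ ≫ res F k ea) :=
    IsHomLift.comp_lift_id_left 𝒵.p k _ _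
  have : 𝒵.p.IsHomLift k (res G k eb ≫ x'.γ) :=
    IsHomLift.comp_lift_id_right 𝒵.p k _ _
  refine Functor.IsStronglyCartesian.ext 𝒵.p h (res F h ha) k ?_
  rw [Category.assoc, res_comp F k h _ rfl ea ha ka, kc, Category.assoc, hc, ← Category.assoc,
    res_comp G k h _ rfl eb hb kb]

lemma IsMor.comp {T' T : C} {h : T' ⟶ T} {x' : FibPt F G T'} {x : FibPt F G T}
    {y' : FibPt G K T'} {y : FibPt G K T} (hx : IsMor h x' x) (hy : IsMor h y' y)
    (e' : x'.b = y'.a) (e : x.b = y.a) : IsMor h (x'.comp y' e') (x.comp y e) := by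
  obtain ⟨xa, xb, xc⟩ := hx
  obtain ⟨ya, yb, yc⟩ := hy
  refine ⟨xa, yb, ?_⟩
  dsimp only [FibPt.comp]
  have h1 : res G (𝟙 T') ((Category.id_comp x'.b).trans e') ≫ res G h xb =
      res G h ya ≫ res G (𝟙 T) ((Category.id_comp x.b).trans e) := by
    rw [res_comp G (𝟙 T') h h (Category.id_comp h) _ _ (xb.trans e'),
      res_comp G h (𝟙 T) h (Category.comp_id h)]
  rw [Category.assoc, Category.assoc, xc, ← Category.assoc (res G _ _), h1, Category.assoc,
    ← Category.assoc, yc, Category.assoc]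

lemma IsMor.symm [IsFibredInGroupoids 𝒵] {T' T : C} {h : T' ⟶ T} {x' : FibPt F G T'}
    {x : FibPt F G T} (hx : IsMor h x' x) : IsMor h x'.symm x.symm := by
  obtain ⟨xa, xb, xc⟩ := hx
  refine ⟨xb, xa, ?_⟩
  dsimp only [FibPt.symm]
  rw [IsIso.inv_comp_eq, ← Category.assoc, xc, Category.assoc, IsIso.hom_inv_id, Category.comp_id]

lemma IsMor.image {𝒲 : BasedCategory.{v₂, u₂} C} (Φ : 𝒵 ⥤ᵇ 𝒲) {T' T : C} {h : T' ⟶ T}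
    {x' : FibPt F G T'} {x : FibPt F G T} (hx : IsMor h x' x) :
    IsMor h (x'.image Φ) (x.image Φ) := by
  obtain ⟨xa, xb, xc⟩ := hx
  refine ⟨xa, xb, ?_⟩
  have := congrArg (fun m => Φ.map m) xc
  rw [Φ.toFunctor.map_comp, Φ.toFunctor.map_comp] at this
  exact this

lemma isMor_unit (F : rep X ⥤ᵇ 𝒵) {T' T : C} (h : T' ⟶ T) {a' : T' ⟶ X} {a : T ⟶ X}
    (e : h ≫ a = a') : IsMor h (FibPt.unit F a') (FibPt.unit F a) :=
  ⟨e, e, by dsimp only [FibPt.unit]; rw [Category.id_comp, Category.comp_id]⟩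

namespace FibPt

lemma comp_assoc {T : C} (x : FibPt F G T) (y : FibPt G K T) (z : FibPt K L T)
    (e : x.b = y.a) (e' : y.b = z.a) :
    (x.comp y e).comp z e' = x.comp (y.comp z e') e := by
  simp only [comp, Category.assoc]

lemma unit_comp {T : C} (x : FibPt F G T) {a : T ⟶ X} (e : a = x.a) :
    (unit F a).comp x e = x := by
  subst e
  dsimp only [comp, unit]
  congr 1
  rw [res_id, Category.id_comp, Category.comp_id]

lemma comp_unit {T : C} (x : FibPt F G T) {b : T ⟶ Y} (e : x.b = b) :
    x.comp (unit G b) e = x := by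
  subst e
  dsimp only [comp, unit]
  congr 1
  rw [res_id, Category.id_comp, Category.id_comp]

lemma comp_eq_right {T : C} {x : FibPt F F T} {y : FibPt F G T} (hx : x = unit F y.a)
    (e : x.b = y.a) : x.comp y e = y := by
  subst hx
  exact unit_comp y _

lemma comp_eq_left {T : C} {x : FibPt F G T} {y : FibPt G G T} (hy : y = unit G x.b)
    (e : x.b = y.a) : x.comp y e = x := by
  subst hy
  exact comp_unit x _

lemma comp_congr {T : C} {x x' : FibPt F G T} {y y' : FibPt G K T} (hx : x = x') (hy : y = y')
    (e : x.b = y.a) (e' : x'.b = y'.a) : x.comp y e = x'.comp y' e' := by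
  subst hx hy
  rfl

lemma comp_symm [IsFibredInGroupoids 𝒵] {T : C} (x : FibPt F G T) :
    x.comp x.symm rfl = unit F x.a := by
  dsimp only [comp, unit, symm]
  congr 1
  rw [res_id, Category.id_comp, IsIso.inv_hom_id]

lemma symm_comp [IsFibredInGroupoids 𝒵] {T : C} (x : FibPt F G T) :
    x.symm.comp x rfl = unit G x.b := by
  dsimp only [comp, unit, symm]
  congr 1
  rw [res_id, Category.id_comp, IsIso.hom_inv_id]

lemma symm_symm [IsFibredInGroupoids 𝒵] {T : C} (x : FibPt F G T) : x.symm.symm = x := by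
  dsimp only [symm]
  congr 1
  exact IsIso.inv_inv

lemma image_comp {𝒲 : BasedCategory.{v₂, u₂} C} (Φ : 𝒵 ⥤ᵇ 𝒲) {T : C} (x : FibPt F G T)
    (y : FibPt G K T) (e : x.b = y.a) :
    (x.comp y e).image Φ = (x.image Φ).comp (y.image Φ) e := by
  dsimp only [comp, image]
  congr 1
  have (x₁ x₂ x₃ x₄ : 𝒵.obj) (f : x₁ ⟶ x₂) (g : x₂ ⟶ x₃) (h : x₃ ⟶ x₄) :
      Φ.map (f ≫ g ≫ h) = Φ.map f ≫ Φ.map g ≫ Φ.map h := by simp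
  exact this _ _ _ _ _ _ _

lemma image_unit {𝒲 : BasedCategory.{v₂, u₂} C} (Φ : 𝒵 ⥤ᵇ 𝒲) {T : C} (a : T ⟶ X) :
    (unit F a).image Φ = unit (F.comp Φ) a := by
  dsimp only [unit, image]
  congr 1
  exact Φ.toFunctor.map_id _

end FibPt

namespace FibProd

/-- The morphism into the fibre product given by a triple. -/
noncomputable def lift (P : FibProd F G) {T : C} (x : FibPt F G T) : T ⟶ P.P :=
  (P.existsUnique x).choose

lemma isMor_lift (P : FibProd F G) {T : C} (x : FibPt F G T) : IsMor (P.lift x) x P.univ :=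
  (P.existsUnique x).choose_spec.1

lemma eq_of_isMor (P : FibProd F G) {T : C} {x : FibPt F G T} {g h : T ⟶ P.P}
    (hg : IsMor g x P.univ) (hh : IsMor h x P.univ) : g = h :=
  (P.existsUnique x).unique hg hh

lemma lift_a (P : FibProd F G) {T : C} (x : FibPt F G T) : P.lift x ≫ P.univ.a = x.a :=
  (P.isMor_lift x).1

lemma lift_b (P : FibProd F G) {T : C} (x : FibPt F G T) : P.lift x ≫ P.univ.b = x.b :=
  (P.isMor_lift x).2.1

lemma comp_lift (P : FibProd F G) {T' T : C} {k : T' ⟶ T} {x' : FibPt F G T'} (x : FibPt F G T)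
    (h : IsMor k x' x) : k ≫ P.lift x = P.lift x' :=
  P.eq_of_isMor (h.trans (P.isMor_lift x)) (P.isMor_lift x')

variable [IsFibredInGroupoids 𝒵]

/-- The triple given by a morphism into the fibre product. -/
noncomputable def pt (P : FibProd F G) {T : C} (h : T ⟶ P.P) : FibPt F G T := P.univ.pull h

lemma pt_lift (P : FibProd F G) {T : C} (x : FibPt F G T) : P.pt (P.lift x) = x := by
  refine (IsMor.cancel (k := 𝟙 T) (h := P.lift x) (x := P.univ) ?_ (P.isMor_lift x)).eq
  rw [Category.id_comp]
  exact FibPt.isMor_pull _ _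

lemma lift_pt (P : FibProd F G) {T : C} (h : T ⟶ P.P) : P.lift (P.pt h) = h :=
  P.eq_of_isMor (P.isMor_lift _) (FibPt.isMor_pull _ _)

lemma pt_injective (P : FibProd F G) {T : C} {g h : T ⟶ P.P} (e : P.pt g = P.pt h) : g = h := by
  rw [← P.lift_pt g, e, P.lift_pt]

lemma isMor_pt (P : FibProd F G) {T' T : C} (k : T' ⟶ T) (h : T ⟶ P.P) :
    IsMor k (P.pt (k ≫ h)) (P.pt h) :=
  IsMor.cancel (FibPt.isMor_pull _ _) (FibPt.isMor_pull _ _)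

/-- Two triples over the same triple, along the same morphism, are equal. -/
lemma _root_.DiffStack.IsMor.unique {T' T : C} {k : T' ⟶ T} {x x' : FibPt F G T'} {y : FibPt F G T}
    (h : IsMor k x y) (h' : IsMor k x' y) : x = x' := by
  refine (IsMor.cancel (k := 𝟙 T') (h := k) (x := y) ?_ h').eq
  rwa [Category.id_comp]

lemma pt_lift_comp (P : FibProd F G) {T' T : C} {k : T' ⟶ T} {x' : FibPt F G T'}
    (x : FibPt F G T) (h : IsMor k x' x) : P.pt (k ≫ P.lift x) = x' := by
  rw [P.comp_lift x h, P.pt_lift]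

/-- `X ×_𝒵 Y` and `Y ×_𝒵 X` are represented by the same object. -/
noncomputable def symm (P : FibProd F G) : FibProd G F where
  P := P.P
  univ := P.univ.symm
  existsUnique x := by
    refine ⟨P.lift x.symm, ?_, fun h hh => ?_⟩
    · have := (P.isMor_lift x.symm).symm
      rwa [FibPt.symm_symm] at this
    · have := hh.symm
      rw [FibPt.symm_symm] at this
      exact P.eq_of_isMor this (P.isMor_lift _)

end FibProd

section Transport

variable {𝒲 : BasedCategory.{v₂, u₂} C}

/-- A 2-morphism `α : p_y ∘ φ ⇒ Φ ∘ p_x` evaluated at `a : T ⟶ X₀`: the morphism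
`α_a : p_y(φ(a)) → Φ(p_x(a))`. -/
def alphaAt {p : rep X ⥤ᵇ 𝒵} {q : rep Y ⥤ᵇ 𝒲} {Φ : 𝒵 ⥤ᵇ 𝒲} {φ : X ⟶ Y}
    (α : BasedNatTrans ((repMap φ).comp q) (p.comp Φ)) {T : C} (a : T ⟶ X) :
    ev q (a ≫ φ) ⟶ ev (p.comp Φ) a :=
  α.app (Over.mk a)

instance alphaAt_isHomLift {p : rep X ⥤ᵇ 𝒵} {q : rep Y ⥤ᵇ 𝒲} {Φ : 𝒵 ⥤ᵇ 𝒲}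
    {φ : X ⟶ Y} (α : BasedNatTrans ((repMap φ).comp q) (p.comp Φ)) {T : C} (a : T ⟶ X) :
    𝒲.p.IsHomLift (𝟙 T) (alphaAt α a) :=
  α.isHomLift' (Over.mk a)

instance alphaAt_isIso [IsFibredInGroupoids 𝒲] {p : rep X ⥤ᵇ 𝒵} {q : rep Y ⥤ᵇ 𝒲}
    {Φ : 𝒵 ⥤ᵇ 𝒲} {φ : X ⟶ Y} (α : BasedNatTrans ((repMap φ).comp q) (p.comp Φ)) {T : C}
    (a : T ⟶ X) : IsIso (alphaAt α a) :=
  isIso_of_lift_id (T := T) (alphaAt α a)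

/-- The triple `(φ(a), α_a⁻¹ ∘ Φ(γ) ∘ α_{a'}, φ(a'))` associated with `(a, γ, a')`. -/
noncomputable def transport [IsFibredInGroupoids 𝒲] {p : rep X ⥤ᵇ 𝒵}
    {q : rep Y ⥤ᵇ 𝒲} {Φ : 𝒵 ⥤ᵇ 𝒲} {φ : X ⟶ Y}
    (α : BasedNatTrans ((repMap φ).comp q) (p.comp Φ)) {T : C} (x : FibPt p p T) :
    FibPt q q T where
  a := x.a ≫ φ
  b := x.b ≫ φ
  γ := alphaAt α x.b ≫ x.imageHom Φ ≫ inv (alphaAt α x.a)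
  isHomLift := inferInstance

end Transport

end Points

end Stacks

/-! ## Lie groupoids and Hilsum–Skandalis bibundles

A smooth map out of a fibre product of manifolds, such as the multiplication of a Lie groupoid, is
given through the Yoneda embedding: as an operation on `T`-points, natural in the manifold `T`. -/

/-- A Lie groupoid `arr ⇉ obj`.  The product `g · h` is defined when `src g = tgt h`. -/
structure LieGroupoid : Type (u + 1) where
  obj : Mfd.{u}
  arr : Mfd.{u}
  src : arr ⟶ obj
  tgt : arr ⟶ obj
  src_submersion : IsSurjSubmersion src
  tgt_submersion : IsSurjSubmersion tgt
  one : obj ⟶ arr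
  inv : arr ⟶ arr
  mul : ∀ {T : Mfd.{u}} (g h : T ⟶ arr), g ≫ src = h ≫ tgt → (T ⟶ arr)
  mul_natural : ∀ {T' T : Mfd.{u}} (k : T' ⟶ T) (g h : T ⟶ arr) (e : g ≫ src = h ≫ tgt)
    (e' : (k ≫ g) ≫ src = (k ≫ h) ≫ tgt), k ≫ mul g h e = mul (k ≫ g) (k ≫ h) e'
  one_src : one ≫ src = 𝟙 obj
  one_tgt : one ≫ tgt = 𝟙 obj
  inv_src : inv ≫ src = tgt
  inv_tgt : inv ≫ tgt = src
  mul_src : ∀ {T : Mfd.{u}} (g h : T ⟶ arr) (e : g ≫ src = h ≫ tgt),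
    mul g h e ≫ src = h ≫ src
  mul_tgt : ∀ {T : Mfd.{u}} (g h : T ⟶ arr) (e : g ≫ src = h ≫ tgt),
    mul g h e ≫ tgt = g ≫ tgt
  mul_assoc : ∀ {T : Mfd.{u}} (g h k : T ⟶ arr) (e₁ : g ≫ src = h ≫ tgt)
    (e₂ : h ≫ src = k ≫ tgt) (e₃ : mul g h e₁ ≫ src = k ≫ tgt)
    (e₄ : g ≫ src = mul h k e₂ ≫ tgt), mul (mul g h e₁) k e₃ = mul g (mul h k e₂) e₄
  one_mul : ∀ {T : Mfd.{u}} (g : T ⟶ arr) (e : ((g ≫ tgt) ≫ one) ≫ src = g ≫ tgt),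
    mul ((g ≫ tgt) ≫ one) g e = g
  mul_one : ∀ {T : Mfd.{u}} (g : T ⟶ arr) (e : g ≫ src = ((g ≫ src) ≫ one) ≫ tgt),
    mul g ((g ≫ src) ≫ one) e = g
  inv_mul : ∀ {T : Mfd.{u}} (g : T ⟶ arr) (e : (g ≫ inv) ≫ src = g ≫ tgt),
    mul (g ≫ inv) g e = (g ≫ src) ≫ one
  mul_inv : ∀ {T : Mfd.{u}} (g : T ⟶ arr) (e : g ≫ src = (g ≫ inv) ≫ tgt),
    mul g (g ≫ inv) e = (g ≫ tgt) ≫ one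

/-- A strict morphism of Lie groupoids: a pair of smooth maps preserving source, target, units and
multiplication. -/
structure StrictHom (X Y : LieGroupoid.{u}) : Type u where
  arrMap : X.arr ⟶ Y.arr
  objMap : X.obj ⟶ Y.obj
  map_src : arrMap ≫ Y.src = X.src ≫ objMap
  map_tgt : arrMap ≫ Y.tgt = X.tgt ≫ objMap
  map_one : X.one ≫ arrMap = objMap ≫ Y.one
  map_mul : ∀ {T : Mfd.{u}} (g h : T ⟶ X.arr) (e : g ≫ X.src = h ≫ X.tgt)
    (e' : (g ≫ arrMap) ≫ Y.src = (h ≫ arrMap) ≫ Y.tgt),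
    X.mul g h e ≫ arrMap = Y.mul (g ≫ arrMap) (h ≫ arrMap) e'

/-- An H.S. (Hilsum–Skandalis) morphism from `X` to `Y`: a manifold `tot` with moment maps
`Jl : tot ⟶ X.obj`, `Jr : tot ⟶ Y.obj` and commuting actions of `X` (left) and `Y` (right), such
that the right action is principal. -/
structure HSBibundle (X Y : LieGroupoid.{u}) : Type (u + 1) where
  tot : Mfd.{u}
  Jl : tot ⟶ X.obj
  Jr : tot ⟶ Y.obj
  lact : ∀ {T : Mfd.{u}} (g : T ⟶ X.arr) (x : T ⟶ tot), g ≫ X.src = x ≫ Jl → (T ⟶ tot)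
  ract : ∀ {T : Mfd.{u}} (x : T ⟶ tot) (h : T ⟶ Y.arr), x ≫ Jr = h ≫ Y.tgt → (T ⟶ tot)
  lact_natural : ∀ {T' T : Mfd.{u}} (k : T' ⟶ T) (g : T ⟶ X.arr) (x : T ⟶ tot)
    (e : g ≫ X.src = x ≫ Jl) (e' : (k ≫ g) ≫ X.src = (k ≫ x) ≫ Jl),
    k ≫ lact g x e = lact (k ≫ g) (k ≫ x) e'
  ract_natural : ∀ {T' T : Mfd.{u}} (k : T' ⟶ T) (x : T ⟶ tot) (h : T ⟶ Y.arr)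
    (e : x ≫ Jr = h ≫ Y.tgt) (e' : (k ≫ x) ≫ Jr = (k ≫ h) ≫ Y.tgt),
    k ≫ ract x h e = ract (k ≫ x) (k ≫ h) e'
  lact_Jl : ∀ {T : Mfd.{u}} (g : T ⟶ X.arr) (x : T ⟶ tot) (e : g ≫ X.src = x ≫ Jl),
    lact g x e ≫ Jl = g ≫ X.tgt
  lact_Jr : ∀ {T : Mfd.{u}} (g : T ⟶ X.arr) (x : T ⟶ tot) (e : g ≫ X.src = x ≫ Jl),
    lact g x e ≫ Jr = x ≫ Jr
  ract_Jl : ∀ {T : Mfd.{u}} (x : T ⟶ tot) (h : T ⟶ Y.arr) (e : x ≫ Jr = h ≫ Y.tgt),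
    ract x h e ≫ Jl = x ≫ Jl
  ract_Jr : ∀ {T : Mfd.{u}} (x : T ⟶ tot) (h : T ⟶ Y.arr) (e : x ≫ Jr = h ≫ Y.tgt),
    ract x h e ≫ Jr = h ≫ Y.src
  one_lact : ∀ {T : Mfd.{u}} (x : T ⟶ tot) (e : ((x ≫ Jl) ≫ X.one) ≫ X.src = x ≫ Jl),
    lact ((x ≫ Jl) ≫ X.one) x e = x
  ract_one : ∀ {T : Mfd.{u}} (x : T ⟶ tot) (e : x ≫ Jr = ((x ≫ Jr) ≫ Y.one) ≫ Y.tgt),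
    ract x ((x ≫ Jr) ≫ Y.one) e = x
  mul_lact : ∀ {T : Mfd.{u}} (g g' : T ⟶ X.arr) (x : T ⟶ tot) (e₁ : g ≫ X.src = g' ≫ X.tgt)
    (e₂ : X.mul g g' e₁ ≫ X.src = x ≫ Jl) (e₃ : g' ≫ X.src = x ≫ Jl)
    (e₄ : g ≫ X.src = lact g' x e₃ ≫ Jl), lact (X.mul g g' e₁) x e₂ = lact g (lact g' x e₃) e₄
  ract_mul : ∀ {T : Mfd.{u}} (x : T ⟶ tot) (h h' : T ⟶ Y.arr) (e₁ : h ≫ Y.src = h' ≫ Y.tgt)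
    (e₂ : x ≫ Jr = Y.mul h h' e₁ ≫ Y.tgt) (e₃ : x ≫ Jr = h ≫ Y.tgt)
    (e₄ : ract x h e₃ ≫ Jr = h' ≫ Y.tgt), ract x (Y.mul h h' e₁) e₂ = ract (ract x h e₃) h' e₄
  lact_ract : ∀ {T : Mfd.{u}} (g : T ⟶ X.arr) (x : T ⟶ tot) (h : T ⟶ Y.arr)
    (e₁ : g ≫ X.src = x ≫ Jl) (e₂ : lact g x e₁ ≫ Jr = h ≫ Y.tgt) (e₃ : x ≫ Jr = h ≫ Y.tgt)
    (e₄ : g ≫ X.src = ract x h e₃ ≫ Jl), ract (lact g x e₁) h e₂ = lact g (ract x h e₃) e₄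
  Jl_submersion : IsSurjSubmersion Jl
  /-- `(x, h) ↦ (x, x · h)` is an isomorphism `tot ×_{Y.obj} Y.arr ≅ tot ×_{X.obj} tot`. -/
  principal : ∀ {T : Mfd.{u}} (x x' : T ⟶ tot), x ≫ Jl = x' ≫ Jl →
    ∃! h : T ⟶ Y.arr, ∃ e : x ≫ Jr = h ≫ Y.tgt, ract x h e = x'

/-- The bibundle `E` is the H.S. bibundle `X₀ ×_{f₀, Y₀, tgt} Y₁` of the strict morphism `f`:
there is a map `q : E → Y₁` exhibiting `E` as this fibre product, with moment maps
`(a, y) ↦ a` and `(a, y) ↦ src y`, left action `g · (a, y) = (tgt g, f₁(g) · y)` and right action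
`(a, y) · h = (a, y · h)`. -/
def HSBibundle.IsBundleOf {X Y : LieGroupoid.{u}} (E : HSBibundle X Y) (f : StrictHom X Y) :
    Prop :=
  ∃ q : E.tot ⟶ Y.arr, IsPullback E.Jl q f.objMap Y.tgt ∧ E.Jr = q ≫ Y.src ∧
    (∀ {T : Mfd.{u}} (g : T ⟶ X.arr) (x : T ⟶ E.tot) (e : g ≫ X.src = x ≫ E.Jl),
      ∃ e' : (g ≫ f.arrMap) ≫ Y.src = (x ≫ q) ≫ Y.tgt,
        E.lact g x e ≫ q = Y.mul (g ≫ f.arrMap) (x ≫ q) e') ∧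
    (∀ {T : Mfd.{u}} (x : T ⟶ E.tot) (h : T ⟶ Y.arr) (e : x ≫ E.Jr = h ≫ Y.tgt),
      ∃ e' : (x ≫ q) ≫ Y.src = h ≫ Y.tgt, E.ract x h e ≫ q = Y.mul (x ≫ q) h e')

/-! ## Differentiable stacks, charts and presentations -/

/-- A chart of `𝒳`: a manifold `X₀` with a morphism `p : X₀ → 𝒳` which is a representable
surjective submersion: for every manifold `U` and every `f : U → 𝒳` the fibre product `U ×_𝒳 X₀`
is representable by a manifold, whose projection to `U` is a surjective submersion. -/
structure Chart (𝒳 : BasedCategory.{v₁, u₁} Mfd.{u}) where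
  X₀ : Mfd.{u}
  p : rep X₀ ⥤ᵇ 𝒳
  representable : ∀ {U : Mfd.{u}} (f : rep U ⥤ᵇ 𝒳), Nonempty (FibProd f p)
  submersion : ∀ {U : Mfd.{u}} (f : rep U ⥤ᵇ 𝒳) (P : FibProd f p), IsSurjSubmersion P.univ.a

/-- A differentiable stack: a stack over the site of manifolds which admits a chart. -/
class IsDifferentiableStack (𝒳 : BasedCategory.{v₁, u₁} Mfd.{u}) : Prop
    extends IsFibredInGroupoids 𝒳 where
  isStack : IsStack openTopology 𝒳
  exists_chart : Nonempty (Chart 𝒳)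

section Presentation

variable {𝒳 : BasedCategory.{v₁, u₁} Mfd.{u}} {𝒴 : BasedCategory.{v₂, u₂} Mfd.{u}}

/-- The Lie groupoid `X₁ = X₀ ×_𝒳 X₀ ⇉ X₀` presenting `𝒳`, for a chart `X₀` of `𝒳` and a manifold
`X₁` representing the fibre product.  On triples, `tgt (a, γ, a') = a`, `src (a, γ, a') = a'` and
`(a, γ, a') · (a', γ', a'') = (a, γ ∘ γ', a'')`. -/
noncomputable def Chart.groupoid [IsFibredInGroupoids 𝒳] (c : Chart 𝒳) (X₁ : FibProd c.p c.p) :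
    LieGroupoid.{u} where
  obj := c.X₀
  arr := X₁.P
  src := X₁.univ.b
  tgt := X₁.univ.a
  src_submersion := c.submersion c.p X₁.symm
  tgt_submersion := c.submersion c.p X₁
  one := X₁.lift (FibPt.unit c.p (𝟙 c.X₀))
  inv := X₁.lift X₁.univ.symm
  mul g h e := X₁.lift ((X₁.pt g).comp (X₁.pt h) e)
  mul_natural k g h e e' := X₁.eq_of_isMor
    (((X₁.isMor_pt k g).comp (X₁.isMor_pt k h) e' e).trans (X₁.isMor_lift _)) (X₁.isMor_lift _)
  one_src := X₁.lift_b _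
  one_tgt := X₁.lift_a _
  inv_src := X₁.lift_b _
  inv_tgt := X₁.lift_a _
  mul_src _ _ _ := X₁.lift_b _
  mul_tgt _ _ _ := X₁.lift_a _
  mul_assoc g h k e₁ e₂ e₃ e₄ := by
    congr 1
    simp only [FibProd.pt_lift]
    exact FibPt.comp_assoc _ _ _ _ _
  one_mul g e := by
    apply X₁.pt_injective
    rw [X₁.pt_lift]
    have h := X₁.pt_lift_comp (FibPt.unit c.p (𝟙 c.X₀)) (isMor_unit c.p (g ≫ X₁.univ.a)
      (Category.comp_id _))
    simp only [h]
    exact FibPt.unit_comp _ _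
  mul_one g e := by
    apply X₁.pt_injective
    rw [X₁.pt_lift]
    have h := X₁.pt_lift_comp (FibPt.unit c.p (𝟙 c.X₀)) (isMor_unit c.p (g ≫ X₁.univ.b)
      (Category.comp_id _))
    simp only [h]
    exact FibPt.comp_unit _ _
  inv_mul g e := by
    have h := X₁.pt_lift_comp X₁.univ.symm (FibPt.isMor_pull g X₁.univ).symm
    have h' := X₁.comp_lift (FibPt.unit c.p (𝟙 c.X₀)) (isMor_unit c.p (g ≫ X₁.univ.b)
      (Category.comp_id _))
    rw [h']
    congr 1
    simp only [h]
    exact FibPt.symm_comp _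
  mul_inv g e := by
    have h := X₁.pt_lift_comp X₁.univ.symm (FibPt.isMor_pull g X₁.univ).symm
    have h' := X₁.comp_lift (FibPt.unit c.p (𝟙 c.X₀)) (isMor_unit c.p (g ≫ X₁.univ.a)
      (Category.comp_id _))
    rw [h']
    congr 1
    simp only [h]
    exact FibPt.comp_symm _

/-- The H.S. morphism presenting `Φ : 𝒳 → 𝒴` with respect to charts `X₀` and `Y₀`: the bibundle
`E = X₀ ×_{Φ ∘ p_x, 𝒴, p_y} Y₀`, with moment maps the two projections and the actions
`(a', η, a) · (a, γ, b) = (a', Φ(η) ∘ γ, b)` and `(a, γ, b) · (b, δ, b') = (a, γ ∘ δ, b')`. -/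
noncomputable def hsBibundle [IsFibredInGroupoids 𝒳] [IsFibredInGroupoids 𝒴] (c : Chart 𝒳)
    (d : Chart 𝒴) (X₁ : FibProd c.p c.p) (Y₁ : FibProd d.p d.p) (Φ : 𝒳 ⥤ᵇ 𝒴)
    (E : FibProd (c.p.comp Φ) d.p) : HSBibundle (c.groupoid X₁) (d.groupoid Y₁) where
  tot := E.P
  Jl := E.univ.a
  Jr := E.univ.b
  lact g x e := E.lift (((X₁.pt g).image Φ).comp (E.pt x) e)
  ract x h e := E.lift ((E.pt x).comp (Y₁.pt h) e)
  lact_natural k g x e e' := E.comp_lift _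
    (((X₁.isMor_pt k g).image Φ).comp (E.isMor_pt k x) e' e)
  ract_natural k x h e e' := E.comp_lift _ ((E.isMor_pt k x).comp (Y₁.isMor_pt k h) e' e)
  lact_Jl _ _ _ := E.lift_a _
  lact_Jr _ _ _ := E.lift_b _
  ract_Jl _ _ _ := E.lift_a _
  ract_Jr _ _ _ := E.lift_b _
  one_lact x e := by
    apply E.pt_injective
    rw [E.pt_lift]
    refine FibPt.comp_eq_right ?_ _
    exact (congrArg _ (X₁.pt_lift_comp (FibPt.unit c.p (𝟙 c.X₀)) (isMor_unit c.p (x ≫ E.univ.a)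
      (Category.comp_id _)))).trans (FibPt.image_unit Φ _)
  ract_one x e := by
    apply E.pt_injective
    rw [E.pt_lift]
    exact FibPt.comp_eq_left (Y₁.pt_lift_comp (FibPt.unit d.p (𝟙 d.X₀))
      (isMor_unit d.p (x ≫ E.univ.b) (Category.comp_id _))) _
  mul_lact g g' x e₁ e₂ e₃ e₄ := by
    congr 1
    have h : (X₁.pt ((c.groupoid X₁).mul g g' e₁)).image Φ =
        ((X₁.pt g).image Φ).comp ((X₁.pt g').image Φ) e₁ :=
      (congrArg _ (X₁.pt_lift _)).trans (FibPt.image_comp Φ _ _ _)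
    refine (FibPt.comp_congr h (rfl : E.pt x = E.pt x) _ e₃).trans
      ((FibPt.comp_assoc _ _ _ e₁ e₃).trans ?_)
    exact FibPt.comp_congr rfl (E.pt_lift _).symm _ _
  ract_mul x h h' e₁ e₂ e₃ e₄ := by
    congr 1
    have hh : Y₁.pt ((d.groupoid Y₁).mul h h' e₁) = (Y₁.pt h).comp (Y₁.pt h') e₁ := Y₁.pt_lift _
    refine (FibPt.comp_congr rfl hh e₂ e₃).trans ((FibPt.comp_assoc _ _ _ e₃ e₁).symm.trans ?_)
    exact FibPt.comp_congr (E.pt_lift _).symm rfl _ _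
  lact_ract g x h e₁ e₂ e₃ e₄ := by
    congr 1
    simp only [FibProd.pt_lift]
    exact FibPt.comp_assoc _ _ _ _ _
  Jl_submersion := d.submersion (c.p.comp Φ) E
  principal x x' e := by
    have key : (E.pt x).comp ((E.pt x).symm.comp (E.pt x') e) rfl = E.pt x' := by
      rw [← FibPt.comp_assoc (E.pt x) (E.pt x).symm (E.pt x') rfl e]
      simp only [FibPt.comp_symm]
      exact FibPt.unit_comp _ _
    refine ⟨Y₁.lift ((E.pt x).symm.comp (E.pt x') e), ⟨(Y₁.lift_a ((E.pt x).symm.comp (E.pt x') e)).symm, ?_⟩, ?_⟩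
    · apply E.pt_injective
      rw [E.pt_lift]
      simp only [FibProd.pt_lift]
      exact key
    · rintro h ⟨e', rfl⟩
      apply Y₁.pt_injective
      rw [Y₁.pt_lift]
      simp only [FibProd.pt_lift]
      refine .trans ?_ (FibPt.comp_assoc (E.pt x).symm (E.pt x) (Y₁.pt h) rfl e')
      simp only [FibPt.symm_comp]
      exact (FibPt.unit_comp _ _).symm

end Presentation

end DiffStack

/-! The 2-morphism `α` is the same thing as a section `σ(a) = (a, α_a, φ(a))` of the left moment map
`E_Φ → X₀`, and a principal bundle with a section is trivial. Every point of `E_Φ` over `a` is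
uniquely `σ(a) · y` with `y` an arrow of `Y` ending at `φ(a)`, namely `y = σ(a)⁻¹ · x`. This gives
`E_Φ ≅ X₀ ×_{φ,Y₀,t} Y₁`. The right action is untouched by the trivialization, while the left action
of `g` becomes left multiplication by `σ(t g)⁻¹ · Φ(g) · σ(s g)`, which is exactly `φ₁(g)`. Units
and products are preserved because adjacent factors `σ` and `σ⁻¹` cancel.

All computations take place on triples over a test manifold `T`, where they use only associativity,
units and inverses for `FibPt.comp`. A construction on triples that is compatible with base change
(`IsMor`) becomes a smooth map by applying it to the universal triple, and injectivity of `pt` turns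
identities of triples into identities of smooth maps. The algebra rests on `transport_eq_comp` and
`transport_comp_alphaTriple_symm_comp`; the trivialization is `isPullback_bundleMap`. -/

namespace DiffStack

/-! ### Conjugation by the 2-morphism, on triples -/

section Transport

variable {C : Type u} [Category.{v} C] {𝒵 : BasedCategory.{v₁, u₁} C}
  {𝒲 : BasedCategory.{v₂, u₂} C} {X Y : C} {p : rep X ⥤ᵇ 𝒵} {q : rep Y ⥤ᵇ 𝒲} {Φ : 𝒵 ⥤ᵇ 𝒲}
  {φ : X ⟶ Y} (α : BasedNatTrans ((repMap φ).comp q) (p.comp Φ))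

/-- The triple `(a, α_a, φ(a))`. -/
def alphaTriple {T : C} (a : T ⟶ X) : FibPt (p.comp Φ) q T where
  a := a
  b := a ≫ φ
  γ := alphaAt α a
  isHomLift := inferInstance

/-- The required square in `𝒲` is the naturality square of `α`. Thus the triples form one section,
compatible with base change. -/
lemma isMor_alphaTriple {T' T : C} (h : T' ⟶ T) {a' : T' ⟶ X} {a : T ⟶ X} (e : h ≫ a = a') :
    IsMor h (alphaTriple α a') (alphaTriple α a) := by
  have hb : h ≫ a ≫ φ = a' ≫ φ := by rw [← Category.assoc, e]
  exact ⟨e, hb, (α.naturality (Over.homMk h e : Over.mk a' ⟶ Over.mk a)).symm⟩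

variable [IsFibredInGroupoids 𝒲]

/-- Both sides have the same third component up to the identities that `FibPt.comp` inserts at each
junction. Written as a product `σ⁻¹ · Φ(x) · σ`, transport can be handled by associativity and
cancellation alone. -/
lemma transport_eq_comp {T : C} (x : FibPt p p T) :
    transport α x =
      ((alphaTriple α x.a).symm.comp (x.image Φ) rfl).comp (alphaTriple α x.b) rfl := by
  dsimp only [transport, FibPt.comp, FibPt.symm, FibPt.image, alphaTriple]
  congr 1
  rw [res_id, res_id, Category.id_comp, Category.id_comp]

/-- Each of the three factors of the conjugate is compatible with base change. This is what allows
`φ₁` to be defined on the universal triple alone. -/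
lemma IsMor.transport {T' T : C} {h : T' ⟶ T} {x' : FibPt p p T'} {x : FibPt p p T}
    (hx : IsMor h x' x) : IsMor h (transport α x') (transport α x) := by
  rw [transport_eq_comp, transport_eq_comp]
  obtain ⟨ha, hb, -⟩ := id hx
  exact ((isMor_alphaTriple α h ha).symm.comp (hx.image Φ) _ _).comp (isMor_alphaTriple α h hb) _ _

/-- This cancellation and the next one say that `y ↦ σ(a) · y` and `x ↦ σ(a)⁻¹ · x` are mutually
inverse. -/
lemma alphaTriple_comp_symm_comp {Z : C} {G : rep Z ⥤ᵇ 𝒲} {T : C} {a : T ⟶ X}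
    (x : FibPt (p.comp Φ) G T) (e : a = x.a) :
    (alphaTriple α a).comp ((alphaTriple α a).symm.comp x e) rfl = x := by
  refine (FibPt.comp_assoc _ _ _ rfl _).symm.trans ?_
  simp only [FibPt.comp_symm]
  exact FibPt.unit_comp _ _

lemma alphaTriple_symm_comp_comp {Z : C} {G : rep Z ⥤ᵇ 𝒲} {T : C} {a : T ⟶ X}
    (y : FibPt q G T) (e : a ≫ φ = y.a) :
    (alphaTriple α a).symm.comp ((alphaTriple α a).comp y e) rfl = y := by
  refine (FibPt.comp_assoc _ _ _ rfl _).symm.trans ?_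
  simp only [FibPt.symm_comp]
  exact FibPt.unit_comp _ _

lemma transport_unit {T : C} (a : T ⟶ X) :
    transport α (FibPt.unit p a) = FibPt.unit q (a ≫ φ) := by
  rw [transport_eq_comp]
  simp only [FibPt.image_unit]
  refine (FibPt.comp_congr (FibPt.comp_unit _ _) rfl _ ?_).trans (FibPt.symm_comp (alphaTriple α a))
  rfl

/-- `(α⁻¹ ∘ Φ(γ) ∘ α) · (α⁻¹ ∘ γ') = α⁻¹ ∘ Φ(γ) ∘ γ'`. -/
lemma transport_comp_alphaTriple_symm_comp {Z : C} {G : rep Z ⥤ᵇ 𝒲} {T : C} (x : FibPt p p T)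
    (y : FibPt (p.comp Φ) G T) {a : T ⟶ X} (ea : a = y.a) (e : x.b = y.a)
    (e' : (transport α x).b = ((alphaTriple α a).symm.comp y ea).a) :
    (transport α x).comp ((alphaTriple α a).symm.comp y ea) e' =
      (alphaTriple α x.a).symm.comp ((x.image Φ).comp y e) rfl := by
  obtain rfl : x.b = a := e.trans ea.symm
  refine (FibPt.comp_congr (transport_eq_comp α x) rfl _ rfl).trans ?_
  refine (FibPt.comp_assoc _ (alphaTriple α x.b) _ rfl rfl).trans ?_
  -- The last factor `σ(x.b)` of the conjugate meets the leading `σ(x.b)⁻¹` of the second triple.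
  refine (FibPt.comp_congr rfl (alphaTriple_comp_symm_comp α y e) _ e).trans ?_
  exact FibPt.comp_assoc _ _ _ _ _

/-- Since `transport α y = σ⁻¹ · (Φ(y) · σ)`, this is the preceding lemma applied to the triple
`Φ(y) · σ`, together with functoriality of `Φ`. -/
lemma transport_comp {T : C} (x y : FibPt p p T) (e : x.b = y.a)
    (e' : (transport α x).b = (transport α y).a) :
    transport α (x.comp y e) = (transport α x).comp (transport α y) e' := by
  have hy : transport α y = (alphaTriple α y.a).symm.comp
      ((y.image Φ).comp (alphaTriple α y.b) rfl) rfl :=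
    (transport_eq_comp α y).trans (FibPt.comp_assoc _ _ _ _ _)
  refine .trans ?_ (FibPt.comp_congr rfl hy.symm e' e')
  refine .trans ?_ (transport_comp_alphaTriple_symm_comp α x
    ((y.image Φ).comp (alphaTriple α y.b) rfl) rfl e e').symm
  refine (transport_eq_comp α _).trans ((FibPt.comp_assoc _ _ _ _ _).trans ?_)
  refine FibPt.comp_congr rfl ?_ _ _
  exact (FibPt.comp_congr (FibPt.image_comp Φ x y e) rfl _ rfl).trans
    (FibPt.comp_assoc _ _ _ _ _)

end Transport

/-! ### Trivialization of the bibundle and the strict morphism -/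

section Presentation

variable {𝒳 : BasedCategory.{v₁, u₁} Mfd.{u}} {𝒴 : BasedCategory.{v₂, u₂} Mfd.{u}}
  [IsFibredInGroupoids 𝒴] {cX : Chart 𝒳} {cY : Chart 𝒴}
  {Φ : 𝒳 ⥤ᵇ 𝒴} {φ : cX.X₀ ⟶ cY.X₀}
  (α : BasedNatTrans ((repMap φ).comp cY.p) (cX.p.comp Φ))
  (Y₁ : FibProd cY.p cY.p) (E : FibProd (cX.p.comp Φ) cY.p)

/-- The map `(a, γ, b) ↦ (φ(a), α_a⁻¹ ∘ γ, b)`. -/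
noncomputable def bundleMap : E.P ⟶ Y₁.P :=
  Y₁.lift ((alphaTriple α E.univ.a).symm.comp E.univ rfl)

lemma pt_bundleMap {T : Mfd.{u}} (x : T ⟶ E.P) :
    Y₁.pt (x ≫ bundleMap α Y₁ E) = (alphaTriple α (x ≫ E.univ.a)).symm.comp (E.pt x) rfl :=
  Y₁.pt_lift_comp _ ((isMor_alphaTriple α x rfl).symm.comp (FibPt.isMor_pull x E.univ) _ _)

/-- Variant for a point of `E` given by its triple, which is how both actions produce their values.
-/
lemma pt_lift_bundleMap {T : Mfd.{u}} (z : FibPt (cX.p.comp Φ) cY.p T) :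
    Y₁.pt (E.lift z ≫ bundleMap α Y₁ E) = (alphaTriple α z.a).symm.comp z rfl :=
  Y₁.pt_lift_comp _ ((isMor_alphaTriple α _ (E.lift_a z)).symm.comp (E.isMor_lift z) _ _)

lemma bundleMap_tgt : bundleMap α Y₁ E ≫ Y₁.univ.a = E.univ.a ≫ φ := Y₁.lift_a _

lemma bundleMap_src : bundleMap α Y₁ E ≫ Y₁.univ.b = E.univ.b := Y₁.lift_b _

/-- The inverse of the trivialization sends `(a, y)` to `σ(a) · y`; the two cancellation lemmas give
existence and uniqueness. -/
lemma isPullback_bundleMap : IsPullback E.univ.a (bundleMap α Y₁ E) φ Y₁.univ.a := by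
  refine IsPullback.of_isLimit' ⟨(bundleMap_tgt α Y₁ E).symm⟩ (Limits.PullbackCone.IsLimit.mk _
    -- The cone condition says that `y` ends at `φ(a)`, so `σ(a)` and `y` are composable.
    (fun s => E.lift ((alphaTriple α s.fst).comp (Y₁.pt s.snd) s.condition))
    (fun s => E.lift_a _) (fun s => ?_) (fun s m hm hm' => ?_))
  · apply Y₁.pt_injective
    rw [pt_lift_bundleMap]
    exact alphaTriple_symm_comp_comp α _ _
  · apply E.pt_injective
    rw [FibProd.pt_lift]
    -- In terms of `m`, the competing point becomes `σ · (σ⁻¹ · m)`, hence `m` itself.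
    simp only [← hm, ← hm', pt_bundleMap]
    exact (alphaTriple_comp_symm_comp α _ _).symm

variable [IsFibredInGroupoids 𝒳] (X₁ : FibProd cX.p cX.p)

/-- The smooth map `(a, γ, a') ↦ (φ(a), α_a⁻¹ ∘ Φ(γ) ∘ α_{a'}, φ(a'))`. -/
noncomputable def transportMap : X₁.P ⟶ Y₁.P := Y₁.lift (transport α X₁.univ)

lemma pt_transportMap {T : Mfd.{u}} (g : T ⟶ X₁.P) :
    Y₁.pt (g ≫ transportMap α Y₁ X₁) = transport α (X₁.pt g) :=
  Y₁.pt_lift_comp _ ((FibPt.isMor_pull g X₁.univ).transport α)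

/-- The strict morphism of presenting groupoids induced by `φ` and `α`. -/
noncomputable def transportHom : StrictHom (cX.groupoid X₁) (cY.groupoid Y₁) where
  arrMap := transportMap α Y₁ X₁
  objMap := φ
  map_src := Y₁.lift_b _
  map_tgt := Y₁.lift_a _
  map_one := by
    apply Y₁.pt_injective
    refine (pt_transportMap α Y₁ X₁ _).trans ?_
    refine .trans ?_ (Y₁.pt_lift_comp (FibPt.unit cY.p (𝟙 cY.X₀))
      (isMor_unit cY.p φ (Category.comp_id _))).symm
    -- The unit section is the lift of the unit triple at `𝟙`, so transport yields the unit at `𝟙 ≫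
    -- φ`.
    refine (congrArg _ (X₁.pt_lift _)).trans ((transport_unit α _).trans ?_)
    exact congrArg (FibPt.unit cY.p) (Category.id_comp φ)
  map_mul g h e e' := by
    apply Y₁.pt_injective
    refine (pt_transportMap α Y₁ X₁ _).trans (.trans ?_ (Y₁.pt_lift _).symm)
    have hg := pt_transportMap α Y₁ X₁ g
    have hh := pt_transportMap α Y₁ X₁ h
    have e'' : (transport α (X₁.pt g)).b = (transport α (X₁.pt h)).a :=
      congrArg (· ≫ φ) e
    refine (congrArg _ (X₁.pt_lift _)).trans ((transport_comp α _ _ e e'').trans ?_)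
    exact FibPt.comp_congr hg.symm hh.symm _ _

/-- Left equivariance is the identity `φ₁(g) · (σ⁻¹ · x) = σ⁻¹ · (Φ(g) · x)`. Right equivariance is
associativity, because `σ⁻¹` multiplies on the other side. -/
lemma isBundleOf_transportHom :
    (hsBibundle cX cY X₁ Y₁ Φ E).IsBundleOf (transportHom α Y₁ X₁) := by
  refine ⟨bundleMap α Y₁ E, isPullback_bundleMap α Y₁ E, (bundleMap_src α Y₁ E).symm,
    fun {T} g x e => ?_, fun {T} x h e => ?_⟩
  · have hg := pt_transportMap α Y₁ X₁ g
    have hx := pt_bundleMap α Y₁ E x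
    have e'' : (transport α (X₁.pt g)).b =
      ((alphaTriple α (x ≫ E.univ.a)).symm.comp (E.pt x) rfl).a := congrArg (· ≫ φ) e
    refine ⟨(congrArg FibPt.b hg).trans (e''.trans (congrArg FibPt.a hx).symm),
      Y₁.pt_injective ?_⟩
    refine (pt_lift_bundleMap α Y₁ E _).trans (.trans ?_ (Y₁.pt_lift _).symm)
    refine .trans ?_ (FibPt.comp_congr hg.symm hx.symm e'' _)
    exact (transport_comp_alphaTriple_symm_comp α (X₁.pt g) (E.pt x) rfl e e'').symm
  · have hx := pt_bundleMap α Y₁ E x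
    have e'' : ((alphaTriple α (x ≫ E.univ.a)).symm.comp (E.pt x) rfl).b = (Y₁.pt h).a := e
    refine ⟨(congrArg FibPt.b hx).trans e'', Y₁.pt_injective ?_⟩
    refine (pt_lift_bundleMap α Y₁ E _).trans (.trans ?_ (Y₁.pt_lift _).symm)
    refine .trans ?_ (FibPt.comp_congr hx.symm (rfl : Y₁.pt h = Y₁.pt h) e'' _)
    exact (FibPt.comp_assoc _ _ _ rfl e).symm

end Presentation

end DiffStack

/-- The formula on `T`-points determines `f.arrMap`: take `g` to be the identity of `X₁.P` and use
that `Y₁.pt` is injective. -/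
theorem mainTheorem7 {𝒳 : BasedCategory.{v₁, u₁} DiffStack.Mfd.{u}}
    {𝒴 : BasedCategory.{v₂, u₂} DiffStack.Mfd.{u}}
    [DiffStack.IsDifferentiableStack 𝒳] [DiffStack.IsDifferentiableStack 𝒴]
    (cX : DiffStack.Chart 𝒳) (cY : DiffStack.Chart 𝒴)
    (Φ : 𝒳 ⥤ᵇ 𝒴) (φ : cX.X₀ ⟶ cY.X₀)
    (α : BasedNatTrans ((DiffStack.repMap φ).comp cY.p) (cX.p.comp Φ))
    (X₁ : DiffStack.FibProd cX.p cX.p) (Y₁ : DiffStack.FibProd cY.p cY.p)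
    (E : DiffStack.FibProd (cX.p.comp Φ) cY.p) :
    ∃ f : DiffStack.StrictHom (cX.groupoid X₁) (cY.groupoid Y₁),
      f.objMap = φ ∧
      (∀ {T : DiffStack.Mfd.{u}} (g : T ⟶ X₁.P),
        Y₁.pt (g ≫ f.arrMap) = DiffStack.transport α (X₁.pt g)) ∧
      (DiffStack.hsBibundle cX cY X₁ Y₁ Φ E).IsBundleOf f :=
  ⟨DiffStack.transportHom α Y₁ X₁, rfl, DiffStack.pt_transportMap α Y₁ X₁,
    DiffStack.isBundleOf_transportHom α Y₁ E X₁⟩
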